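/- Graphs are finite, simple and nonempty. Let $\Delta(G)$ be the maximum degree of $G$, let $\mathrm{tw}(G)$ be its treewidth, and let $\mathrm{dtw}(G)$ be its domino treewidth, i.e. the minimum width of a tree decomposition of $G$ in which every vertex lies in at most two bags. A tree-layout of $G$ is a rooted tree $T$ with node set $V(G)$ such that for every edge $xy$ of $G$ one of $x,y$ is an ancestor of the other in $T$. The pruned subtree $T^p[x]$ of a vertex $x$ consists of $x$ together with all vertices $y$ of the subtree of $T$ rooted at $x$ such that some descendant of $y$ (possibly $y$ itself) is a neighbour of $x$ in $G$. The treespan $\mathrm{ts}(G)$ is the minimum of $\max_{x\in V(G)}|T^p[x]|-1$ over all tree-layouts $T$ of $G$. Theorem. Treespan and domino treewidth are polynomially tied: there are polynomials $f,g$ such that for every graph $G$, $$\mathrm{ts}(G)\le f(\mathrm{dtw}(G))\quad\text{and}\quad \mathrm{dtw}(G)\le g(\mathrm{ts}(G)).$$ More precisely, every graph $G$ satisfies $$\max\bigl(\mathrm{tw}(G),\Delta(G)/2\bigr)\le \mathrm{ts}(G)\le 2\,\mathrm{dtw}(G),$$ and there is an absolute constant $C$ such that every graph $G$ satisfies $\mathrm{dtw}(G)\le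 C\cdot\mathrm{tw}(G)\cdot\Delta(G)^2$. -/

import Mathlib

open Polynomial

universe u

namespace SimpleGraph

variable {V : Type u}

/-- A tree decomposition of `G` whose tree has node set `ι`. -/
structure TreeDecomposition (G : SimpleGraph V) (ι : Type) where
  /-- The underlying tree. -/
  tree : SimpleGraph ι
  isTree : tree.IsTree
  /-- The bag of each node. -/
  bag : ι → Finset V
  /-- The nodes whose bags contain `v` induce a nonempty connected subtree
  (`Connected` includes nonemptiness). -/
  connected_induce : ∀ v : V, (tree.induce {t | v ∈ bag t}).Connected
  /-- Every edge is contained in some bag. -/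
  exists_bag_of_adj : ∀ {u v : V}, G.Adj u v → ∃ t, u ∈ bag t ∧ v ∈ bag t

namespace TreeDecomposition

variable {G : SimpleGraph V} {ι : Type} [Fintype ι]

/-- The width: the maximum size of a bag, minus one. If `V` is nonempty, then some bag is
nonempty, so the subtraction is not truncated. -/
def width (D : TreeDecomposition G ι) : ℕ :=
  (Finset.univ.sup fun t => (D.bag t).card) - 1

/-- Every vertex lies in at most two bags. -/
def IsDomino (D : TreeDecomposition G ι) : Prop :=
  ∀ v : V, {t : ι | v ∈ D.bag t}.ncard ≤ 2

end TreeDecomposition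

/-- Treewidth: the minimum width over all (finite) tree decompositions. The node set may be
taken in `Type`, since every finite type is equivalent to some `Fin n`. -/
noncomputable def treewidth (G : SimpleGraph V) : ℕ :=
  sInf {w | ∃ (ι : Type) (_ : Fintype ι) (D : TreeDecomposition G ι), D.width = w}

/-- Domino treewidth: the minimum width over all (finite) domino tree decompositions. -/
noncomputable def dominoTreewidth (G : SimpleGraph V) : ℕ :=
  sInf {w | ∃ (ι : Type) (_ : Fintype ι) (D : TreeDecomposition G ι),
    D.IsDomino ∧ D.width = w}

/-- `x` is an ancestor of `y` (possibly `x = y`) in the tree `T` rooted at `r`: `x` lies on the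
path of `T` from `r` to `y`. -/
def IsAncestorIn (T : SimpleGraph V) (r x y : V) : Prop :=
  ∃ p : T.Walk r y, p.IsPath ∧ x ∈ p.support

/-- A tree-layout of `G`: a rooted tree on the vertex set of `G` such that the two ends of each
edge of `G` are in ancestor-descendant relation. -/
structure TreeLayout (G : SimpleGraph V) where
  /-- The underlying tree. -/
  tree : SimpleGraph V
  isTree : tree.IsTree
  /-- The root. -/
  root : V
  comparable_of_adj : ∀ {x y : V}, G.Adj x y →
    IsAncestorIn tree root x y ∨ IsAncestorIn tree root y x

namespace TreeLayout

variable {G : SimpleGraph V}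

/-- `x` is an ancestor of `y` (equivalently, `y` is a descendant of `x`), possibly `x = y`. -/
def IsAncestor (L : TreeLayout G) (x y : V) : Prop :=
  IsAncestorIn L.tree L.root x y

/-- The pruned subtree of `x`: its root `x`, together with all vertices of the subtree rooted at
`x` that have a neighbour of `x` among their descendants (each vertex being a descendant of
itself). If `x` has a neighbour below it, then `x` satisfies the second condition as well; keeping
`x` in any case only fixes the value for graphs without edges. -/
def prunedSubtree (L : TreeLayout G) (x : V) : Set V :=
  {y | y = x ∨ (L.IsAncestor x y ∧ ∃ z, G.Adj x z ∧ L.IsAncestor y z)}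

/-- The elimination span: the maximum size of a pruned subtree, minus one. -/
noncomputable def elimSpan [Fintype V] (L : TreeLayout G) : ℕ :=
  (Finset.univ.sup fun x => (L.prunedSubtree x).ncard) - 1

end TreeLayout

/-- Treespan: the minimum elimination span over all tree-layouts. -/
noncomputable def treespan [Fintype V] (G : SimpleGraph V) : ℕ :=
  sInf {s | ∃ L : TreeLayout G, L.elimSpan = s}

/-- Two graph parameters are polynomially tied if each is bounded by a polynomial function of the
other, over all finite nonempty graphs. Natural coefficients are no restriction, since a real
polynomial is bounded on `ℕ` by one with natural coefficients. -/
def PolynomiallyTied (p q : ∀ (V : Type u) [Fintype V], SimpleGraph V → ℕ) : Prop :=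
  ∃ f g : ℕ[X], ∀ (V : Type u) [Fintype V] [Nonempty V] (G : SimpleGraph V),
    p V G ≤ f.eval (q V G) ∧ q V G ≤ g.eval (p V G)

end SimpleGraph

/-! Lower bounds on treespan. Fix a tree-layout and give each node y the bag of all x whose pruned
subtree contains y. These bags form a tree decomposition on the layout tree. The members of one bag
are ancestors of y, hence a chain, and the topmost member has all of them in its pruned subtree; so
tw ≤ ts. The same topmost argument bounds the neighbours above a vertex, while those below lie in
its own pruned subtree; so Δ ≤ 2 ts.

Upper bound on treespan. Root a domino tree decomposition and order the vertices by their topmost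
bags, breaking ties by an enumeration. This is the ancestor order of a tree-layout in which the
pruned subtree of x lies in the at most two bags containing x; so ts ≤ 2 dtw.

Upper bound on domino treewidth. A graph of treewidth k and maximum degree Δ ≥ 1 has a
tree-partition with parts of size O(kΔ) (`exists_isTreePartition_of_subset`). Adding to each part
its neighbours in the child parts gives a domino decomposition, at the cost of another factor Δ + 1.
The tree-partition is built recursively with a prescribed set S in the root part: a small S becomes
the root part and its neighbours are prescribed next; a large S is split by a bag of the tree
decomposition, and the two solutions are glued at their roots.

Polynomial tying follows by substituting tw ≤ ts and Δ ≤ 2 ts into the last bound. -/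

namespace SimpleGraph

/-! ### The ancestor relation of a rooted tree. -/

section Ancestor

variable {V : Type*} {T : SimpleGraph V} {r x y z : V}

theorem IsTree.isAncestorIn_iff (hT : T.IsTree) {p : T.Walk r y} (hp : p.IsPath) :
    IsAncestorIn T r x y ↔ x ∈ p.support := by
  constructor
  · rintro ⟨q, hq, hx⟩
    rwa [(hT.existsUnique_path r y).unique hp hq]
  · exact fun hx => ⟨p, hp, hx⟩

theorem IsTree.isAncestorIn_refl (hT : T.IsTree) (r x : V) : IsAncestorIn T r x x := by
  obtain ⟨p, hp, -⟩ := hT.existsUnique_path r x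
  exact ⟨p, hp, p.end_mem_support⟩

theorem IsTree.isAncestorIn_root (hT : T.IsTree) (r x : V) : IsAncestorIn T r r x := by
  obtain ⟨p, hp, -⟩ := hT.existsUnique_path r x
  exact ⟨p, hp, p.start_mem_support⟩

theorem IsTree.isAncestorIn_trans (hT : T.IsTree) (h₁ : IsAncestorIn T r x y)
    (h₂ : IsAncestorIn T r y z) : IsAncestorIn T r x z := by
  classical
  obtain ⟨p, hp, hy⟩ := h₂
  have := (hT.isAncestorIn_iff (hp.takeUntil hy)).1 h₁
  exact ⟨p, hp, p.support_takeUntil_subset_support hy this⟩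

theorem IsTree.isAncestorIn_antisymm (hT : T.IsTree) (h₁ : IsAncestorIn T r x y)
    (h₂ : IsAncestorIn T r y x) : x = y := by
  classical
  obtain ⟨p, hp, hx⟩ := h₁
  by_contra hne
  exact Walk.endpoint_notMem_support_takeUntil hp hx (Ne.symm hne)
    ((hT.isAncestorIn_iff (hp.takeUntil hx)).1 h₂)

theorem Walk.IsPath.isAncestorIn_of_mem_dropUntil [DecidableEq V] {p : T.Walk r z} (hp : p.IsPath)
    (hx : x ∈ p.support) (hy : y ∈ (p.dropUntil x hx).support) : IsAncestorIn T r x y := by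
  have h : p = ((p.takeUntil x hx).append ((p.dropUntil x hx).takeUntil y hy)).append
      ((p.dropUntil x hx).dropUntil y hy) := by
    rw [← Walk.append_assoc, Walk.take_spec, Walk.take_spec]
  rw [h] at hp
  exact ⟨_, hp.of_append_left, by simp⟩

theorem isAncestorIn_total (h₁ : IsAncestorIn T r x z) (h₂ : IsAncestorIn T r y z) (hT : T.IsTree) :
    IsAncestorIn T r x y ∨ IsAncestorIn T r y x := by
  classical
  obtain ⟨p, hp, hx⟩ := h₁
  have hy := (hT.isAncestorIn_iff hp).1 h₂
  rw [← p.take_spec hx, Walk.mem_support_append_iff] at hy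
  rcases hy with hy | hy
  · exact .inr ⟨_, hp.takeUntil hx, hy⟩
  · exact .inl (Walk.IsPath.isAncestorIn_of_mem_dropUntil hp hx hy)

/-- The path between an ancestor and a descendant stays between the two. -/
theorem exists_walk_of_isAncestorIn (h : IsAncestorIn T r x y) :
    ∃ p : T.Walk x y, ∀ w ∈ p.support, IsAncestorIn T r x w ∧ IsAncestorIn T r w y := by
  classical
  obtain ⟨p, hp, hx⟩ := h
  exact ⟨p.dropUntil x hx, fun w hw => ⟨Walk.IsPath.isAncestorIn_of_mem_dropUntil hp hx hw,
    p, hp, p.support_dropUntil_subset_support hx hw⟩⟩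

theorem IsTree.isAncestorIn_total_of_adj (hT : T.IsTree) (r : V) (h : T.Adj x y) :
    IsAncestorIn T r x y ∨ IsAncestorIn T r y x := by
  obtain ⟨p, hp, -⟩ := hT.existsUnique_path r x
  by_cases hy : y ∈ p.support
  · exact .inr ⟨p, hp, hy⟩
  · exact .inl ⟨p.concat h, hp.concat hy h, by simp [Walk.support_concat]⟩

/-- The root path of a child is that of its parent plus one node, so nothing fits strictly between
them. This is what confines pruned subtrees to two bags. -/
theorem IsTree.eq_or_eq_of_isAncestorIn_of_adj (hT : T.IsTree) (h : T.Adj x z)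
    (h₁ : IsAncestorIn T r x y) (h₂ : IsAncestorIn T r y z) : y = x ∨ y = z := by
  obtain ⟨p, hp, -⟩ := hT.existsUnique_path r x
  by_cases hz : z ∈ p.support
  · exact absurd (hT.isAncestorIn_antisymm (hT.isAncestorIn_trans h₁ h₂) ⟨p, hp, hz⟩) h.ne
  · have := (hT.isAncestorIn_iff (hp.concat hz h)).1 h₂
    rw [Walk.support_concat, List.mem_append, List.mem_singleton] at this
    rcases this with hy | hy
    · exact .inl (hT.isAncestorIn_antisymm ⟨p, hp, hy⟩ h₁)
    · exact .inr hy

end Ancestor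

/-! ### Rooted trees from parent maps and from orders. -/

section ParentGraph

variable {V : Type*} {p : V → V} {r : V} {h : V → ℕ}

/-- The graph that joins each vertex to its parent. -/
def parentGraph (p : V → V) : SimpleGraph V :=
  fromRel fun x y => p x = y

theorem parentGraph_adj {x y : V} :
    (parentGraph p).Adj x y ↔ x ≠ y ∧ (p x = y ∨ p y = x) := Iff.rfl

theorem iterate_height_le (hr : p r = r) (hp : ∀ v, v ≠ r → h (p v) < h v) (k : ℕ) (v : V) :
    h (p^[k] v) ≤ h v := by
  induction k generalizing v with
  | zero => rfl
  | succ k ih =>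
    rw [Function.iterate_succ_apply]
    refine (ih _).trans ?_
    by_cases hv : v = r
    · rw [hv, hr]
    · exact (hp v hv).le

/-- Extend the root path of the parent by one edge; heights never increase along iterates, so `y` is
not already on that path. -/
theorem exists_isPath_parentGraph (hr : p r = r) (hp : ∀ v, v ≠ r → h (p v) < h v) (y : V) :
    ∃ q : (parentGraph p).Walk r y, q.IsPath ∧ ∀ x, x ∈ q.support ↔ ∃ k, p^[k] y = x := by
  induction hn : h y using Nat.strong_induction_on generalizing y with
  | _ n ih =>
    by_cases hy : y = r
    · subst hy
      refine ⟨.nil, .nil, fun x => ?_⟩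
      simp [Function.iterate_fixed hr, eq_comm]
    · have hlt := hp y hy
      obtain ⟨q, hq, hs⟩ := ih _ (hn ▸ hlt) (p y) rfl
      have hadj : (parentGraph p).Adj (p y) y :=
        ⟨fun e => by rw [e] at hlt; exact hlt.false, .inr rfl⟩
      have hmem : y ∉ q.support := by
        rw [hs]
        rintro ⟨k, hk⟩
        have := iterate_height_le hr hp k (p y)
        rw [hk] at this
        omega
      refine ⟨q.concat hadj, hq.concat hmem hadj, fun x => ?_⟩
      rw [Walk.support_concat, List.mem_append, List.mem_singleton, hs]
      constructor
      · rintro (⟨k, hk⟩ | rfl)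
        · exact ⟨k + 1, hk⟩
        · exact ⟨0, rfl⟩
      · rintro ⟨_ | k, hk⟩
        · exact .inr hk.symm
        · exact .inl ⟨k, hk⟩

/-- Each edge has the form `s(v, p v)` with `v ≠ r`, so a connected graph on n vertices has at most
n - 1 edges here. -/
theorem isTree_parentGraph [Finite V] (hr : p r = r) (hp : ∀ v, v ≠ r → h (p v) < h v) :
    (parentGraph p).IsTree := by
  have hc : (parentGraph p).Connected := connected_iff_exists_forall_reachable _ |>.2
    ⟨r, fun y => (exists_isPath_parentGraph hr hp y).choose.reachable⟩
  refine isTree_iff_connected_and_card.2 ⟨hc, le_antisymm ?_ hc.card_vert_le_card_edgeSet_add_one⟩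
  have hsub : (parentGraph p).edgeSet ⊆ (fun v => s(v, p v)) '' {r}ᶜ := by
    intro e
    induction e with
    | _ x y =>
      rw [mem_edgeSet, parentGraph_adj]
      rintro ⟨hne, rfl | rfl⟩
      · exact ⟨x, fun hx => hne (by rw [Set.mem_singleton_iff] at hx; rw [hx, hr]), rfl⟩
      · exact ⟨y, fun hx => hne (by rw [Set.mem_singleton_iff] at hx; rw [hx, hr]), Sym2.eq_swap⟩
  have h1 := (Set.ncard_le_ncard hsub (Set.toFinite _)).trans (Set.ncard_image_le (Set.toFinite _))
  have h2 := Set.ncard_add_ncard_compl ({r} : Set V)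
  rw [Set.ncard_singleton] at h2
  rw [Nat.card_coe_set_eq]
  omega

theorem isAncestorIn_parentGraph [Finite V] (hr : p r = r) (hp : ∀ v, v ≠ r → h (p v) < h v)
    {x y : V} : IsAncestorIn (parentGraph p) r x y ↔ ∃ k, p^[k] y = x := by
  obtain ⟨q, hq, hs⟩ := exists_isPath_parentGraph hr hp y
  rw [(isTree_parentGraph hr hp).isAncestorIn_iff hq, hs]

end ParentGraph

/-- A finite partial order with a least element in which the elements below any given one form a
chain is the ancestor order of a rooted tree. -/
theorem exists_isTree_isAncestorIn_iff_le {V : Type*} [Finite V] [PartialOrder V] [OrderBot V]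
    (hchain : ∀ x y z : V, x ≤ z → y ≤ z → x ≤ y ∨ y ≤ x) :
    ∃ T : SimpleGraph V, T.IsTree ∧ ∀ x y, IsAncestorIn T ⊥ x y ↔ x ≤ y := by
  classical
  have hpar : ∀ y : V, ∃ q, (y = ⊥ → q = ⊥) ∧ (y ≠ ⊥ → q < y ∧ ∀ x < y, x ≤ q) := by
    intro y
    by_cases hy : y = ⊥
    · exact ⟨⊥, by simp [hy]⟩
    -- The elements below `y` form a chain, so a maximal one is the greatest: it is the parent.
    · obtain ⟨q, hq⟩ := (Set.toFinite (Set.Iio y)).exists_maximal ⟨⊥, bot_lt_iff_ne_bot.2 hy⟩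
      refine ⟨q, fun h => absurd h hy, fun _ => ⟨hq.1, fun x hx => ?_⟩⟩
      rcases hchain x q y hx.le hq.1.le with h | h
      · exact h
      · exact hq.2 hx h
  choose p hp0 hp1 using hpar
  have hr : p ⊥ = ⊥ := hp0 ⊥ rfl
  have hh : ∀ v, v ≠ ⊥ → (Set.Iio (p v)).ncard < (Set.Iio v).ncard := fun v hv =>
    Set.ncard_lt_ncard (Set.ssubset_iff_of_subset
      (Set.Iio_subset_Iio (hp1 v hv).1.le) |>.2 ⟨p v, (hp1 v hv).1, by simp⟩) (Set.toFinite _)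
  have hle : ∀ v, p v ≤ v := fun v => by
    by_cases hv : v = ⊥
    · rw [hv, hr]
    · exact (hp1 v hv).1.le
  refine ⟨parentGraph p, isTree_parentGraph (h := fun v => (Set.Iio v).ncard) hr hh, fun x y => ?_⟩
  rw [isAncestorIn_parentGraph (h := fun v => (Set.Iio v).ncard) hr hh]
  constructor
  · rintro ⟨k, rfl⟩
    induction k generalizing y with
    | zero => exact le_rfl
    | succ k ih => exact (ih (p y)).trans (hle y)
  · intro hxy
    induction hn : (Set.Iio y).ncard using Nat.strong_induction_on generalizing y with
    | _ n ih =>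
      rcases hxy.eq_or_lt with rfl | hlt
      · exact ⟨0, rfl⟩
      · have hy : y ≠ ⊥ := fun h => not_lt_bot (h ▸ hlt)
        obtain ⟨k, hk⟩ := ih _ (hn ▸ hh y hy) (p y) ((hp1 y hy).2 x hlt) rfl
        exact ⟨k + 1, hk⟩

section Topmost

variable {V : Type*} {T : SimpleGraph V} {r y : V}

/-- Ancestors of a common node form a chain. The topmost one will have a pruned subtree containing
all the others. -/
theorem IsTree.exists_topmost (hT : T.IsTree) {s : Finset V} (hs : s.Nonempty)
    (h : ∀ x ∈ s, IsAncestorIn T r x y) : ∃ a ∈ s, ∀ x ∈ s, IsAncestorIn T r a x := by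
  induction hs using Finset.Nonempty.cons_induction with
  | singleton a =>
    exact ⟨a, by simp, by simpa using hT.isAncestorIn_refl r a⟩
  | cons b s hb hs ih =>
    obtain ⟨a, ha, hax⟩ := ih fun x hx => h x (Finset.mem_cons_of_mem hx)
    rcases isAncestorIn_total (h a (Finset.mem_cons_of_mem ha)) (h b (Finset.mem_cons_self b s)) hT
      with hab | hba
    · refine ⟨a, Finset.mem_cons_of_mem ha, fun x hx => ?_⟩
      rcases Finset.mem_cons.1 hx with rfl | hx
      exacts [hab, hax x hx]
    · refine ⟨b, Finset.mem_cons_self b s, fun x hx => ?_⟩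
      rcases Finset.mem_cons.1 hx with rfl | hx
      exacts [hT.isAncestorIn_refl r _, hT.isAncestorIn_trans hba (hax x hx)]

end Topmost

theorem connected_induce_of_forall_exists_walk {V : Type*} {T : SimpleGraph V} {s : Set V} {u : V}
    (hu : u ∈ s) (h : ∀ v ∈ s, ∃ p : T.Walk u v, ∀ w ∈ p.support, w ∈ s) :
    (T.induce s).Connected := by
  refine connected_iff_exists_forall_reachable _ |>.2 ⟨⟨u, hu⟩, fun ⟨v, hv⟩ => ?_⟩
  obtain ⟨p, hp⟩ := h v hv
  exact (p.induce s hp).reachable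

/-! ### Basic facts on widths; the minima are attained. -/

namespace TreeDecomposition

variable {V : Type*} {G : SimpleGraph V} {ι : Type}

theorem exists_mem_bag (D : TreeDecomposition G ι) (v : V) : ∃ t, v ∈ D.bag t :=
  let ⟨t⟩ := (D.connected_induce v).nonempty
  ⟨t, t.2⟩

variable [Fintype ι]

theorem card_bag_le (D : TreeDecomposition G ι) (t : ι) : (D.bag t).card ≤ D.width + 1 := by
  have := Finset.le_sup (f := fun t => (D.bag t).card) (Finset.mem_univ t)
  unfold width
  omega

theorem width_le (D : TreeDecomposition G ι) {w : ℕ} (h : ∀ t, (D.bag t).card ≤ w + 1) :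
    D.width ≤ w := by
  have := Finset.sup_le (s := Finset.univ) (f := fun t => (D.bag t).card) fun t _ => h t
  unfold width
  omega

theorem treewidth_le (D : TreeDecomposition G ι) : G.treewidth ≤ D.width :=
  Nat.sInf_le ⟨ι, inferInstance, D, rfl⟩

theorem dominoTreewidth_le (D : TreeDecomposition G ι) (h : D.IsDomino) :
    G.dominoTreewidth ≤ D.width :=
  Nat.sInf_le ⟨ι, inferInstance, D, h, rfl⟩

end TreeDecomposition

section Attained

variable {V : Type*} [Fintype V] (G : SimpleGraph V)

/-- The tree decomposition with a single bag. -/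
def TreeDecomposition.single : TreeDecomposition G Unit where
  tree := ⊥
  isTree := .of_subsingleton
  bag _ := Finset.univ
  connected_induce v := by
    have : Nonempty {t : Unit | v ∈ (Finset.univ : Finset V)} := ⟨⟨(), Finset.mem_univ v⟩⟩
    exact .of_subsingleton
  exists_bag_of_adj _ := ⟨(), Finset.mem_univ _, Finset.mem_univ _⟩

theorem TreeDecomposition.single_isDomino : (TreeDecomposition.single G).IsDomino := fun _ =>
  (Set.ncard_le_card _).trans (by simp)

/-- The one-bag decomposition rules out the default value `sInf ∅ = 0`. -/
theorem exists_width_eq_treewidth : ∃ (ι : Type) (_ : Fintype ι) (D : TreeDecomposition G ι),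
    D.width = G.treewidth :=
  Nat.sInf_mem (s := {w | ∃ (ι : Type) (_ : Fintype ι) (D : TreeDecomposition G ι), D.width = w})
    ⟨_, Unit, inferInstance, TreeDecomposition.single G, rfl⟩

theorem exists_width_eq_dominoTreewidth :
    ∃ (ι : Type) (_ : Fintype ι) (D : TreeDecomposition G ι),
      D.IsDomino ∧ D.width = G.dominoTreewidth :=
  Nat.sInf_mem (s := {w | ∃ (ι : Type) (_ : Fintype ι) (D : TreeDecomposition G ι),
    D.IsDomino ∧ D.width = w})
    ⟨_, Unit, inferInstance, TreeDecomposition.single G, TreeDecomposition.single_isDomino G, rfl⟩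

end Attained

/-! ### Treewidth and degree are bounded by the elimination span. -/

namespace TreeLayout

variable {V : Type*} {G : SimpleGraph V} (L : TreeLayout G)

theorem self_mem_prunedSubtree (x : V) : x ∈ L.prunedSubtree x :=
  .inl rfl

theorem mem_prunedSubtree_of_isAncestor {x y z : V} (hxz : G.Adj x z) (h₁ : L.IsAncestor x y)
    (h₂ : L.IsAncestor y z) : y ∈ L.prunedSubtree x :=
  .inr ⟨h₁, z, hxz, h₂⟩

theorem isAncestor_of_mem_prunedSubtree {x y : V} (h : y ∈ L.prunedSubtree x) :
    L.IsAncestor x y := by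
  rcases h with rfl | h
  · exact L.isTree.isAncestorIn_refl _ _
  · exact h.1

/-- Convexity of pruned subtrees: it gives both the connectedness of the bags and the bound on their
size. -/
theorem mem_prunedSubtree_of_le {x y z : V} (h : z ∈ L.prunedSubtree x) (h₁ : L.IsAncestor x y)
    (h₂ : L.IsAncestor y z) : y ∈ L.prunedSubtree x := by
  rcases h with rfl | ⟨-, w, hw, hzw⟩
  · exact .inl (L.isTree.isAncestorIn_antisymm h₂ h₁)
  · exact .inr ⟨h₁, w, hw, L.isTree.isAncestorIn_trans h₂ hzw⟩

variable [Fintype V]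

theorem ncard_prunedSubtree_le (x : V) : (L.prunedSubtree x).ncard ≤ L.elimSpan + 1 := by
  have := Finset.le_sup (f := fun x => (L.prunedSubtree x).ncard) (Finset.mem_univ x)
  unfold elimSpan
  omega

theorem elimSpan_le {w : ℕ} (h : ∀ x, (L.prunedSubtree x).ncard ≤ w + 1) : L.elimSpan ≤ w := by
  have := Finset.sup_le (s := Finset.univ) (f := fun x => (L.prunedSubtree x).ncard) fun x _ => h x
  unfold elimSpan
  omega

theorem treespan_le : G.treespan ≤ L.elimSpan :=
  Nat.sInf_le ⟨L, rfl⟩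

/-- The bag of a vertex `y` consists of the vertices whose pruned subtree contains `y`. -/
theorem treewidth_le : G.treewidth ≤ L.elimSpan := by
  classical
  -- Decomposition nodes must live in `Type`, so the layout tree is transported from `V` to `Fin`.
  let e := Fintype.equivFin V
  let φ : L.tree ≃g L.tree.comap e.symm := (Iso.comap e.symm L.tree).symm
  have hφ : ∀ v x, v ∈ ({y | e.symm (φ.toHom x) ∈ L.prunedSubtree y} : Finset V) ↔
      x ∈ L.prunedSubtree v := fun v x => by
    have : e.symm (φ.toHom x) = x := e.symm_apply_apply x
    rw [Finset.mem_filter_univ, this]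
  let D : TreeDecomposition G (Fin (Fintype.card V)) :=
    { tree := L.tree.comap e.symm
      isTree := φ.isTree_iff.1 L.isTree
      bag := fun t => {x | e.symm t ∈ L.prunedSubtree x}
      connected_induce := fun v => by
        refine connected_induce_of_forall_exists_walk (u := φ.toHom v)
          ((hφ v v).2 (L.self_mem_prunedSubtree v))
          fun t ht => ?_
        obtain ⟨t, rfl⟩ := φ.surjective t
        have ht : t ∈ L.prunedSubtree v := (hφ v t).1 ht
        obtain ⟨p, hp⟩ := exists_walk_of_isAncestorIn (L.isAncestor_of_mem_prunedSubtree ht)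
        refine ⟨p.map φ.toHom, fun w hw => ?_⟩
        rw [Walk.support_map, List.mem_map] at hw
        obtain ⟨x, hx, rfl⟩ := hw
        exact (hφ v x).2 (L.mem_prunedSubtree_of_le ht (hp x hx).1 (hp x hx).2)
      exists_bag_of_adj := fun {u v} huv => by
        rcases L.comparable_of_adj huv with h | h
        · refine ⟨e v, ?_, ?_⟩
          · simpa using L.mem_prunedSubtree_of_isAncestor huv h (L.isTree.isAncestorIn_refl _ _)
          · simp [L.self_mem_prunedSubtree]
        · refine ⟨e u, ?_, ?_⟩
          · simp [L.self_mem_prunedSubtree]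
          · simpa using
              L.mem_prunedSubtree_of_isAncestor huv.symm h (L.isTree.isAncestorIn_refl _ _) }
  refine D.treewidth_le.trans (D.width_le fun t => ?_)
  have hanc : ∀ x ∈ D.bag t, L.IsAncestor x (e.symm t) := fun x hx =>
    L.isAncestor_of_mem_prunedSubtree (by simpa [D] using hx)
  have hne : (D.bag t).Nonempty := ⟨e.symm t, by simp [D, L.self_mem_prunedSubtree]⟩
  -- Every member of the bag lies between `a` and the node `e.symm t`, which is in the pruned
  -- subtree of `a`; by convexity the whole bag is in it.
  obtain ⟨a, ha, hax⟩ := L.isTree.exists_topmost hne hanc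
  have hsub : (D.bag t : Set V) ⊆ L.prunedSubtree a := fun x hx =>
    L.mem_prunedSubtree_of_le (by simpa [D] using ha) (hax x hx) (hanc x hx)
  rw [← Set.ncard_coe_finset]
  exact (Set.ncard_le_ncard hsub (Set.toFinite _)).trans (L.ncard_prunedSubtree_le a)

/-- Neighbours below `x` lie in its pruned subtree; those above all lie in that of the topmost one.
Both pruned subtrees also contain `x`, which absorbs the `+ 1`. -/
theorem degree_le [DecidableRel G.Adj] (x : V) : G.degree x ≤ 2 * L.elimSpan := by
  classical
  let down := (G.neighborFinset x).filter fun y => L.IsAncestor x y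
  let up := (G.neighborFinset x).filter fun y => ¬ L.IsAncestor x y
  have hdown : down.card + 1 ≤ L.elimSpan + 1 := by
    have hx : x ∉ down := by simp [down]
    rw [← Finset.card_insert_of_notMem hx, ← Set.ncard_coe_finset]
    refine (Set.ncard_le_ncard (fun y hy => ?_) (Set.toFinite _)).trans (L.ncard_prunedSubtree_le x)
    rcases Finset.mem_insert.1 hy with rfl | hy
    · exact .inl rfl
    · simp only [down, Finset.mem_filter, mem_neighborFinset] at hy
      exact L.mem_prunedSubtree_of_isAncestor hy.1 hy.2 (L.isTree.isAncestorIn_refl _ _)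
  have hup : up.card + 1 ≤ L.elimSpan + 1 := by
    have hanc : ∀ y ∈ up, L.IsAncestor y x := fun y hy => by
      simp only [up, Finset.mem_filter, mem_neighborFinset] at hy
      exact (L.comparable_of_adj hy.1).resolve_left hy.2
    rcases up.eq_empty_or_nonempty with hemp | hne
    · simp [hemp]
    have hx : x ∉ up := by simp [up]
    obtain ⟨a, ha, hay⟩ := L.isTree.exists_topmost hne hanc
    have hadj : G.Adj a x := by
      simp only [up, Finset.mem_filter, mem_neighborFinset] at ha
      exact ha.1.symm
    rw [← Finset.card_insert_of_notMem hx, ← Set.ncard_coe_finset]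
    refine (Set.ncard_le_ncard (fun y hy => ?_) (Set.toFinite _)).trans (L.ncard_prunedSubtree_le a)
    rcases Finset.mem_insert.1 hy with rfl | hy
    · exact L.mem_prunedSubtree_of_isAncestor hadj (hanc a ha) (L.isTree.isAncestorIn_refl _ _)
    · exact L.mem_prunedSubtree_of_isAncestor hadj (hay y hy) (hanc y hy)
  have := Finset.card_filter_add_card_filter_not (s := G.neighborFinset x)
    (fun y => L.IsAncestor x y)
  rw [card_neighborFinset_eq_degree] at this
  simp only [down, up] at hdown hup
  omega

end TreeLayout

/-! ### From domino tree decompositions to tree-layouts. -/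

/-- A partial order with a least element, with chains below each element, and in which adjacent
vertices are comparable is the ancestor order of a tree-layout. -/
theorem exists_treeLayout_isAncestor_iff {V : Type*} [Finite V] {G : SimpleGraph V}
    (le : V → V → Prop) (r : V) (refl : ∀ x, le x x) (trans : ∀ x y z, le x y → le y z → le x z)
    (antisymm : ∀ x y, le x y → le y x → x = y) (bot : ∀ x, le r x)
    (chain : ∀ x y z, le x z → le y z → le x y ∨ le y x)
    (hG : ∀ x y, G.Adj x y → le x y ∨ le y x) :
    ∃ L : TreeLayout G, ∀ x y, L.IsAncestor x y ↔ le x y := by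
  let : PartialOrder V :=
    { le := le, le_refl := refl, le_trans := trans, le_antisymm := antisymm }
  let : OrderBot V := { bot := r, bot_le := bot }
  obtain ⟨T, hT, h⟩ := exists_isTree_isAncestorIn_iff_le chain
  exact ⟨⟨T, hT, r, fun {x y} hxy => (hG x y hxy).imp (h x y).2 (h y x).2⟩, h⟩

namespace TreeDecomposition

variable {V : Type*} {G : SimpleGraph V} {ι : Type}

/-- In a rooted domino tree decomposition each vertex lies in its topmost bag, and possibly in one
more bag just below. -/
theorem IsDomino.exists_top [Finite ι] {D : TreeDecomposition G ι} (hD : D.IsDomino) (r : ι)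
    (v : V) : ∃ t, v ∈ D.bag t ∧ ∀ t', v ∈ D.bag t' →
      t' = t ∨ (D.tree.Adj t t' ∧ IsAncestorIn D.tree r t t' ∧
        ∀ t'', v ∈ D.bag t'' → t'' = t ∨ t'' = t') := by
  obtain ⟨t, ht⟩ := (D.connected_induce v).nonempty
  by_cases hall : ∀ t', v ∈ D.bag t' → t' = t
  · exact ⟨t, ht, fun t' h => .inl (hall t' h)⟩
  push Not at hall
  obtain ⟨c, hc, hct⟩ := hall
  have hpair : {t : ι | v ∈ D.bag t} = {t, c} := by
    refine (Set.eq_of_subset_of_ncard_le ?_ ?_ (Set.toFinite _)).symm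
    · rintro x (rfl | rfl)
      exacts [ht, hc]
    · rw [Set.ncard_pair hct.symm]
      exact hD v
  have hmem : ∀ s, v ∈ D.bag s → s = t ∨ s = c := fun s hs => by
    have : s ∈ {t : ι | v ∈ D.bag t} := hs
    rwa [hpair] at this
  have hadj : D.tree.Adj t c := by
    have hpre := (D.connected_induce v).preconnected
    have : Nontrivial {t : ι | v ∈ D.bag t} :=
      ⟨⟨t, ht⟩, ⟨c, hc⟩, fun h => hct (Subtype.ext_iff.1 h).symm⟩
    obtain ⟨⟨s, hs⟩, hs'⟩ := hpre.exists_adj_of_nontrivial ⟨t, ht⟩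
    have hs' : D.tree.Adj t s := hs'
    rcases hmem s hs with rfl | rfl
    · exact absurd hs' (D.tree.irrefl)
    · exact hs'
  rcases D.isTree.isAncestorIn_total_of_adj r hadj with h | h
  · refine ⟨t, ht, fun t' ht' => (hmem t' ht').imp_right ?_⟩
    rintro rfl
    exact ⟨hadj, h, hmem⟩
  · refine ⟨c, hc, fun t' ht' => (hmem t' ht').symm.imp_right ?_⟩
    rintro rfl
    exact ⟨hadj.symm, h, fun s hs => (hmem s hs).symm⟩

variable [Fintype V] [Nonempty V] [Fintype ι]

/-- If `y` lies between `x` and a neighbour `z`, then `top y` lies between `top x` and a bag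
containing both `x` and `z`. That bag is `top x` or its child, so `y` is in one of the two bags of
`x`. Since `x` itself is in both, the union has at most 2(w + 1) - 1 elements. -/
theorem IsDomino.exists_treeLayout {D : TreeDecomposition G ι} (hD : D.IsDomino) :
    ∃ L : TreeLayout G, L.elimSpan ≤ 2 * D.width := by
  classical
  obtain ⟨v₀⟩ := ‹Nonempty V›
  obtain ⟨r, hr⟩ := D.exists_mem_bag v₀
  have hT := D.isTree
  choose top htop hbag using hD.exists_top r
  have hanc : ∀ {v t}, v ∈ D.bag t → IsAncestorIn D.tree r (top v) t := fun {v t} h => by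
    rcases hbag v t h with rfl | h
    · exact hT.isAncestorIn_refl _ _
    · exact h.2.1
  have htop₀ : top v₀ = r := hT.isAncestorIn_antisymm (hanc hr) (hT.isAncestorIn_root _ _)
  let e := Fintype.equivFin V
  -- The root bag was chosen nonempty so that some vertex has it as its top; the first such vertex
  -- in the enumeration is the least element of the order.
  obtain ⟨b, hb, hbmin⟩ := Finset.exists_min_image (Finset.univ.filter fun v => top v = r) e
    ⟨v₀, by simpa using htop₀⟩
  simp only [Finset.mem_filter_univ] at hb hbmin
  let le : V → V → Prop := fun x y =>
    IsAncestorIn D.tree r (top x) (top y) ∧ (top x = top y → e x ≤ e y)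
  have total : ∀ x y t, IsAncestorIn D.tree r (top x) t → IsAncestorIn D.tree r (top y) t →
      le x y ∨ le y x := fun x y t hx hy => by
    by_cases hxy : top x = top y
    · rcases le_total (e x) (e y) with h | h
      · exact .inl ⟨hxy ▸ hT.isAncestorIn_refl _ _, fun _ => h⟩
      · exact .inr ⟨hxy ▸ hT.isAncestorIn_refl _ _, fun _ => h⟩
    · exact (isAncestorIn_total hx hy hT).imp (fun h => ⟨h, fun h' => absurd h' hxy⟩)
        fun h => ⟨h, fun h' => absurd h'.symm hxy⟩
  obtain ⟨L, hL⟩ := exists_treeLayout_isAncestor_iff (G := G) le b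
    (fun x => ⟨hT.isAncestorIn_refl _ _, fun _ => le_rfl⟩)
    (fun x y z hxy hyz => ⟨hT.isAncestorIn_trans hxy.1 hyz.1, fun h => by
      have hxy' : top x = top y := hT.isAncestorIn_antisymm hxy.1 (h ▸ hyz.1)
      exact (hxy.2 hxy').trans (hyz.2 (hxy' ▸ h))⟩)
    (fun x y hxy hyx => by
      have h := hT.isAncestorIn_antisymm hxy.1 hyx.1
      exact e.injective (le_antisymm (hxy.2 h) (hyx.2 h.symm)))
    (fun x => ⟨hb ▸ hT.isAncestorIn_root _ _, fun h => hbmin x (h ▸ hb)⟩)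
    (fun x y z hx hy => total x y _ hx.1 hy.1)
    (fun x y hxy => by
      obtain ⟨t, hx, hy⟩ := D.exists_bag_of_adj hxy
      exact total x y t (hanc hx) (hanc hy))
  refine ⟨L, L.elimSpan_le fun x => ?_⟩
  have key : ∀ y ∈ L.prunedSubtree x, y ∈ D.bag (top x) ∨
      ∃ c, x ∈ D.bag c ∧ y ∈ D.bag c ∧ y ≠ x ∧ ∀ t, x ∈ D.bag t → t = top x ∨ t = c := by
    intro y hy
    by_cases hyx : y = x
    · exact .inl (hyx ▸ htop x)
    rcases hy with rfl | ⟨hxy, z, hxz, hyz⟩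
    · exact .inl (htop _)
    obtain ⟨t, hx, hz⟩ := D.exists_bag_of_adj hxz
    have hxy' := ((hL x y).1 hxy).1
    have hyt := hT.isAncestorIn_trans ((hL y z).1 hyz).1 (hanc hz)
    rcases hbag x t hx with rfl | ⟨hadj, -, honly⟩
    · rw [hT.isAncestorIn_antisymm hxy' hyt]
      exact .inl (htop y)
    · rcases hT.eq_or_eq_of_isAncestorIn_of_adj hadj hxy' hyt with h | h
      · exact .inl (h ▸ htop y)
      · exact .inr ⟨t, hx, h ▸ htop y, hyx, honly⟩
  by_cases hc : ∃ c, x ∈ D.bag c ∧ c ≠ top x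
  · obtain ⟨c, hxc, hct⟩ := hc
    have hsub : L.prunedSubtree x ⊆ ((D.bag (top x) ∪ (D.bag c).erase x : Finset V) : Set V) := by
      intro y hy
      rw [Finset.mem_coe, Finset.mem_union, Finset.mem_erase]
      rcases key y hy with h | ⟨c', hxc', hyc', hne, hall⟩
      · exact .inl h
      · rcases hall c hxc with h | rfl
        · exact absurd h hct
        · exact .inr ⟨hne, hyc'⟩
    have h1 := Set.ncard_le_ncard hsub (Set.toFinite _)
    rw [Set.ncard_coe_finset] at h1
    have h2 := Finset.card_union_le (D.bag (top x)) ((D.bag c).erase x)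
    rw [Finset.card_erase_of_mem hxc] at h2
    have h3 := D.card_bag_le (top x)
    have h4 := D.card_bag_le c
    omega
  · push Not at hc
    have hsub : L.prunedSubtree x ⊆ (D.bag (top x) : Set V) := by
      intro y hy
      rcases key y hy with h | ⟨c, hxc, hyc, -⟩
      · exact h
      · exact hc c hxc ▸ hyc
    have h1 := Set.ncard_le_ncard hsub (Set.toFinite _)
    rw [Set.ncard_coe_finset] at h1
    have h3 := D.card_bag_le (top x)
    omega

end TreeDecomposition

section Bounds

variable {V : Type*} [Fintype V] [Nonempty V] (G : SimpleGraph V)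

theorem treespan_le_two_mul_dominoTreewidth : G.treespan ≤ 2 * G.dominoTreewidth := by
  obtain ⟨ι, _, D, hD, hw⟩ := G.exists_width_eq_dominoTreewidth
  obtain ⟨L, hL⟩ := hD.exists_treeLayout
  exact hw ▸ L.treespan_le.trans hL

/-- The minimum is attained once some layout exists; the one-bag decomposition supplies one. -/
theorem exists_elimSpan_eq_treespan : ∃ L : TreeLayout G, L.elimSpan = G.treespan := by
  obtain ⟨L, -⟩ := (TreeDecomposition.single_isDomino G).exists_treeLayout
  exact Nat.sInf_mem (s := {s | ∃ L : TreeLayout G, L.elimSpan = s}) ⟨_, L, rfl⟩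

theorem treewidth_le_treespan : G.treewidth ≤ G.treespan := by
  obtain ⟨L, hL⟩ := G.exists_elimSpan_eq_treespan
  exact hL ▸ L.treewidth_le

theorem maxDegree_le_two_mul_treespan [DecidableRel G.Adj] : G.maxDegree ≤ 2 * G.treespan := by
  obtain ⟨L, hL⟩ := G.exists_elimSpan_eq_treespan
  exact hL ▸ G.maxDegree_le_of_forall_degree_le _ L.degree_le

end Bounds

/-! ### Balanced separations from a tree decomposition. -/

theorem Reachable.of_forall_adj {V : Type*} {T : SimpleGraph V} {P : V → Prop} {x y : V}
    (hxy : T.Reachable x y) (hx : P x) (h : ∀ u v, P u → T.Adj u v → P v) : P y := by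
  obtain ⟨p⟩ := hxy
  induction p with
  | nil => exact hx
  | cons hadj p ih => exact ih (h _ _ hx hadj)

/-- A node set `N` of a tree whose only link to the outside is the node `t ∈ N` can be split along
an edge at `t` into two smaller such sets. -/
theorem IsTree.exists_split {ι : Type*} [DecidableEq ι] {T : SimpleGraph ι} (hT : T.IsTree)
    {N : Finset ι} {t : ι} (ht : t ∈ N) (hN : ∀ n ∈ N, ∀ n' ∉ N, T.Adj n n' → n = t)
    (hne : N ≠ {t}) :
    ∃ M ⊂ N, ∃ c ∈ M, t ∈ N \ M ∧ (∀ n ∈ M, ∀ n' ∉ M, T.Adj n n' → n = c) ∧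
      ∀ n ∈ N \ M, ∀ n' ∉ N \ M, T.Adj n n' → n = t := by
  classical
  obtain ⟨c, hc, htc⟩ : ∃ c ∈ N, T.Adj t c := by
    by_contra! hno
    obtain ⟨n, hn, hnt⟩ : ∃ n ∈ N, n ≠ t := by
      by_contra! h
      exact hne (Finset.eq_singleton_iff_unique_mem.2 ⟨ht, h⟩)
    refine (Reachable.of_forall_adj (P := fun n => n ∈ N ∧ n ≠ t) (hT.connected.preconnected n t)
      ⟨hn, hnt⟩ ?_).2 rfl
    rintro u v ⟨hu, hut⟩ huv
    refine ⟨by_contra fun hv => hut (hN u hu v hv huv), ?_⟩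
    rintro rfl
    exact hno u hu huv.symm
  -- The piece split off is the component of `c` after deleting the bridge `tc`, which is then its
  -- only link to the rest.
  set T' := T.deleteEdges {s(t, c)} with hT'
  have hbridge : ¬ T'.Reachable c t := fun h => by
    have := isAcyclic_iff_forall_adj_isBridge.1 hT.isAcyclic htc
    exact (isBridge_iff.1 this) h.symm
  have hleave : ∀ n n', T'.Reachable c n → ¬ T'.Reachable c n' → T.Adj n n' → n = c ∧ n' = t := by
    intro n n' hn hn' hadj
    have heq : s(n, n') = s(t, c) := by
      by_contra hne'
      exact hn' (hn.trans (Adj.reachable (by rw [hT', deleteEdges_adj]; exact ⟨hadj, hne'⟩)))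
    rcases Sym2.eq_iff.1 heq with ⟨rfl, rfl⟩ | h
    · exact absurd hn hbridge
    · exact h
  have hsub : ∀ n, T'.Reachable c n → n ∈ N := fun n hn => by
    refine (Reachable.of_forall_adj (P := fun n => n ∈ N ∧ T'.Reachable c n) hn
      ⟨hc, .rfl⟩ ?_).1
    rintro u v ⟨hu, hcu⟩ huv
    refine ⟨by_contra fun hv => hbridge ?_, hcu.trans huv.reachable⟩
    exact hN u hu v hv ((deleteEdges_le _) huv) ▸ hcu
  have hmem : ∀ n, n ∈ N.filter (T'.Reachable c) ↔ T'.Reachable c n := fun n => by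
    rw [Finset.mem_filter, and_iff_right_iff_imp]
    exact hsub n
  refine ⟨N.filter (T'.Reachable c), ?_, c, (hmem c).2 .rfl, ?_, ?_, ?_⟩
  · refine (Finset.ssubset_iff_of_subset (Finset.filter_subset _ _)).2 ⟨t, ht, ?_⟩
    rwa [hmem]
  · rw [Finset.mem_sdiff, hmem]
    exact ⟨ht, hbridge⟩
  · intro n hn n' hn' hadj
    rw [hmem] at hn hn'
    exact (hleave n n' hn hn' hadj).1
  · intro n hn n' hn' hadj
    rw [Finset.mem_sdiff, hmem] at hn hn'
    by_cases h : n' ∈ N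
    · have : T'.Reachable c n' := by_contra fun h' => hn' ⟨h, h'⟩
      exact (hleave n' n this hn.2 hadj.symm).2
    · exact hN n hn.1 n' h hadj

namespace TreeDecomposition

variable {V : Type*} {G : SimpleGraph V} {ι : Type} [DecidableEq V]

/-- The subtree of `v` could leave `N` only through `t`, whose bag avoids `v`. So every bag
containing `v` belongs to `N`, including one that covers the edge. -/
theorem mem_biUnion_bag_of_adj (D : TreeDecomposition G ι) {N : Finset ι} {t : ι}
    (hN : ∀ n ∈ N, ∀ n' ∉ N, D.tree.Adj n n' → n = t) {u v : V} (hv : v ∈ N.biUnion D.bag)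
    (hvt : v ∉ D.bag t) (huv : G.Adj v u) : u ∈ N.biUnion D.bag := by
  obtain ⟨n, hn, hvn⟩ := Finset.mem_biUnion.1 hv
  obtain ⟨s, hvs, hus⟩ := D.exists_bag_of_adj huv
  have := Reachable.of_forall_adj (P := fun x : {t | v ∈ D.bag t} => (x : ι) ∈ N)
    ((D.connected_induce v).preconnected ⟨n, hvn⟩ ⟨s, hvs⟩) hn (by
      rintro ⟨x, hx⟩ ⟨y, hy⟩ hxN hxy
      by_contra hyN
      have hxt := hN x hxN y hyN hxy
      subst hxt
      exact hvt hx)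
  exact Finset.mem_biUnion.2 ⟨s, this, hus⟩

/-- A bag separates off a piece `W` that contains between `m` and `2 * m` vertices of `S`. -/
theorem exists_separation [Fintype ι] (D : TreeDecomposition G ι) {S : Finset V} {m : ℕ}
    (hm : D.width + 1 ≤ m) (hS : m ≤ S.card) :
    ∃ X W : Finset V, X ⊆ W ∧ X.card ≤ D.width + 1 ∧
      (∀ v ∈ W, v ∉ X → ∀ u, G.Adj v u → u ∈ W) ∧ m ≤ (S ∩ W).card ∧ (S ∩ W).card ≤ 2 * m := by
  classical
  suffices h : ∀ (N : Finset ι) (t : ι), t ∈ N → (∀ n ∈ N, ∀ n' ∉ N, D.tree.Adj n n' → n = t) →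
      m ≤ (S ∩ N.biUnion D.bag).card → ∃ X W : Finset V, X ⊆ W ∧ X.card ≤ D.width + 1 ∧
      (∀ v ∈ W, v ∉ X → ∀ u, G.Adj v u → u ∈ W) ∧ m ≤ (S ∩ W).card ∧ (S ∩ W).card ≤ 2 * m by
    obtain ⟨t⟩ := D.isTree.connected.nonempty
    refine h Finset.univ t (Finset.mem_univ t) (fun _ _ n' h => absurd (Finset.mem_univ n') h) ?_
    rwa [Finset.inter_eq_left.2]
    intro v _
    obtain ⟨t, ht⟩ := D.exists_mem_bag v
    exact Finset.mem_biUnion.2 ⟨t, Finset.mem_univ t, ht⟩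
  intro N
  induction N using Finset.strongInduction with
  | H N ih =>
    intro t ht hN hmN
    -- If `N` carries more than 2m vertices of `S`, it is not a single bag, and one of its two
    -- pieces still carries at least m; recurse into that piece.
    by_cases hle : (S ∩ N.biUnion D.bag).card ≤ 2 * m
    · exact ⟨D.bag t, N.biUnion D.bag, Finset.subset_biUnion_of_mem _ ht, D.card_bag_le t,
        fun v hv hvt u huv => D.mem_biUnion_bag_of_adj hN hv hvt huv, hmN, hle⟩
    have hne : N ≠ {t} := by
      rintro rfl
      rw [Finset.singleton_biUnion] at hle
      have := Finset.card_le_card (Finset.inter_subset_right (s₁ := S) (s₂ := D.bag t))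
      have := D.card_bag_le t
      omega
    obtain ⟨M, hMN, c, hc, htM, hM, hNM⟩ := D.isTree.exists_split ht hN hne
    have hunion : S ∩ N.biUnion D.bag = S ∩ M.biUnion D.bag ∪ S ∩ (N \ M).biUnion D.bag := by
      rw [← Finset.inter_union_distrib_left, ← Finset.union_biUnion,
        Finset.union_sdiff_of_subset hMN.1]
    have hcard := Finset.card_union_le (S ∩ M.biUnion D.bag) (S ∩ (N \ M).biUnion D.bag)
    rw [← hunion] at hcard
    by_cases h : m ≤ (S ∩ M.biUnion D.bag).card
    · exact ih M hMN c hc hM h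
    · exact ih (N \ M) (Finset.sdiff_ssubset hMN.1 ⟨c, hc⟩) t htM hNM (by omega)

end TreeDecomposition

/-! ### Tree-partitions: adding a root part, and gluing. -/

/-- A labelling `φ` of the vertices by the nodes of the tree of lists, in which the parent of a
list is its tail, is a tree-partition of `G[U]` if adjacent vertices get equal or adjacent nodes. -/
def IsTreePartition {V : Type*} (G : SimpleGraph V) (U : Finset V) (φ : V → List ℕ) : Prop :=
  ∀ u ∈ U, ∀ v ∈ U, G.Adj u v → φ u = φ v ∨ φ u = (φ v).tail ∨ φ v = (φ u).tail

theorem IsTreePartition.map {V : Type*} {G : SimpleGraph V} {U : Finset V}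
    {φ : V → List ℕ} (h : G.IsTreePartition U φ) (f : ℕ → ℕ) :
    G.IsTreePartition U fun v => (φ v).map f := by
  intro u hu v hv huv
  rcases h u hu v hv huv with h | h | h
  · exact .inl (by simp [h])
  · exact .inr (.inl (by simp [h, List.map_tail]))
  · exact .inr (.inr (by simp [h, List.map_tail]))

section Construct

variable {V : Type*} [DecidableEq V] {G : SimpleGraph V} {U S : Finset V}

/-- Put a new root part `S` above a tree-partition whose root part contains the neighbours
of `S`. -/
theorem IsTreePartition.cons {φ : V → List ℕ} (h : G.IsTreePartition (U \ S) φ)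
    (hS : ∀ u ∈ S, ∀ v ∈ U \ S, G.Adj u v → φ v = []) :
    G.IsTreePartition U fun v => if v ∈ S then [] else φ v ++ [0] := by
  intro u hu v hv huv
  by_cases huS : u ∈ S <;> by_cases hvS : v ∈ S <;> simp only [huS, hvS, if_true, if_false]
  · exact .inl trivial
  · rw [hS u huS v (Finset.mem_sdiff.2 ⟨hv, hvS⟩) huv]
    exact .inr (.inl rfl)
  · rw [hS v hvS u (Finset.mem_sdiff.2 ⟨hu, huS⟩) huv.symm]
    exact .inr (.inr rfl)
  -- Appending 0 at the end moves the old tree below the node `[0]`. The default `[].tail = []` is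
  -- harmless: there the two nodes coincide.
  · have tail : ∀ l l' : List ℕ, l = l'.tail → l ++ [0] = l' ++ [0] ∨
        l ++ [0] = (l' ++ [0]).tail := by
      rintro l (_ | ⟨x, l'⟩) rfl
      · exact .inl rfl
      · exact .inr rfl
    rcases h u (Finset.mem_sdiff.2 ⟨hu, huS⟩) v (Finset.mem_sdiff.2 ⟨hv, hvS⟩) huv with h | h | h
    · exact .inl (by rw [h])
    · exact (tail _ _ h).imp_right .inl
    · exact (tail _ _ h).imp Eq.symm .inr

theorem card_filter_cons_le {φ : V → List ℕ} {p : ℕ} (hS : S.card ≤ p)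
    (hp : ∀ l, ((U \ S).filter fun v => φ v = l).card ≤ p) (l : List ℕ) :
    (U.filter fun v => (if v ∈ S then [] else φ v ++ [0]) = l).card ≤ p := by
  by_cases hl : l = []
  · refine (Finset.card_le_card fun v hv => ?_).trans hS
    by_contra hvS
    simp [hvS, hl] at hv
  · refine (Finset.card_le_card fun v hv => ?_).trans (hp l.dropLast)
    by_cases hvS : v ∈ S
    · simp [hvS, Ne.symm hl] at hv
    · simp only [Finset.mem_filter, if_neg hvS] at hv
      simp [hv.1, hvS, ← hv.2]

/-- Glue two tree-partitions at their root parts. -/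
theorem exists_isTreePartition_glue {X W : Finset V} {φ₁ φ₂ : V → List ℕ}
    (hW : ∀ v ∈ W, v ∉ X → ∀ u, G.Adj v u → u ∈ W)
    (h₁ : G.IsTreePartition (U ∩ W) φ₁) (h₂ : G.IsTreePartition (U.filter fun v => v ∈ W → v ∈ X) φ₂)
    (hX₁ : ∀ v ∈ X ∩ U, φ₁ v = []) (hX₂ : ∀ v ∈ X ∩ U, φ₂ v = []) {p q₁ q₂ : ℕ}
    (hp₁ : ∀ l, ((U ∩ W).filter fun v => φ₁ v = l).card ≤ p)
    (hp₂ : ∀ l, ((U.filter fun v => v ∈ W → v ∈ X).filter fun v => φ₂ v = l).card ≤ p)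
    (hq₁ : ((U ∩ W).filter fun v => φ₁ v = []).card ≤ q₁)
    (hq₂ : ((U.filter fun v => v ∈ W → v ∈ X).filter fun v => φ₂ v = []).card ≤ q₂) :
    ∃ φ : V → List ℕ, G.IsTreePartition U φ ∧ (∀ v ∈ W, φ₁ v = [] → φ v = []) ∧
      (∀ v ∉ W, φ₂ v = [] → φ v = []) ∧ (U.filter fun v => φ v = []).card ≤ q₁ + q₂ ∧
      ∀ l ≠ [], (U.filter fun v => φ v = l).card ≤ p := by
  -- Even entries for one side and odd entries for the other keep the nodes apart, except for the
  -- common root `[]`.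
  set φ : V → List ℕ := fun v =>
    if v ∈ W then (φ₁ v).map (fun x => 2 * x) else (φ₂ v).map fun x => 2 * x + 1 with hφ
  have e₁ : ∀ v ∈ W, φ v = (φ₁ v).map fun x => 2 * x := fun v hv => by simp [hφ, hv]
  have e₂ : ∀ v ∉ W, φ v = (φ₂ v).map fun x => 2 * x + 1 := fun v hv => by simp [hφ, hv]
  have e₂' : ∀ v ∈ U, (v ∈ W → v ∈ X) → φ v = (φ₂ v).map fun x => 2 * x + 1 := fun v hv hvX => by
    by_cases hvW : v ∈ W
    · have := Finset.mem_inter.2 ⟨hvX hvW, hv⟩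
      rw [e₁ v hvW, hX₁ v this, hX₂ v this, List.map_nil, List.map_nil]
    · exact e₂ v hvW
  refine ⟨φ, ?_, ?_, ?_, ?_, ?_⟩
  -- An edge leaving `W` starts in `X`, so each edge lies within one side; vertices of `X ∩ U` have
  -- the root label on both.
  · have main : ∀ u ∈ U, ∀ v ∈ U, (u ∈ W → v ∉ W → u ∈ X) → (v ∈ W → u ∉ W → v ∈ X) → G.Adj u v →
        φ u = φ v ∨ φ u = (φ v).tail ∨ φ v = (φ u).tail := by
      intro u hu v hv h h' huv
      by_cases hb : u ∈ W ∧ v ∈ W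
      · rw [e₁ u hb.1, e₁ v hb.2]
        exact h₁.map _ u (Finset.mem_inter.2 ⟨hu, hb.1⟩) v (Finset.mem_inter.2 ⟨hv, hb.2⟩) huv
      · have hu' : u ∈ W → u ∈ X := fun hw => h hw fun hw' => hb ⟨hw, hw'⟩
        have hv' : v ∈ W → v ∈ X := fun hw => h' hw fun hw' => hb ⟨hw', hw⟩
        rw [e₂' u hu hu', e₂' v hv hv']
        exact h₂.map _ u (Finset.mem_filter.2 ⟨hu, hu'⟩) v (Finset.mem_filter.2 ⟨hv, hv'⟩) huv
    exact fun u hu v hv huv => main u hu v hv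
      (fun huW hvW => by_contra fun hX => hvW (hW u huW hX v huv))
      (fun hvW huW => by_contra fun hX => huW (hW v hvW hX u huv.symm)) huv
  · intro v hv h
    rw [e₁ v hv, h, List.map_nil]
  · intro v hv h
    rw [e₂ v hv, h, List.map_nil]
  · refine (Finset.card_le_card (t := ((U ∩ W).filter fun v => φ₁ v = []) ∪
      ((U.filter fun v => v ∈ W → v ∈ X).filter fun v => φ₂ v = [])) fun v hv => ?_).trans
      ((Finset.card_union_le _ _).trans (add_le_add hq₁ hq₂))
    obtain ⟨hvU, hv⟩ := Finset.mem_filter.1 hv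
    by_cases hvW : v ∈ W
    · rw [e₁ v hvW, List.map_eq_nil_iff] at hv
      simp [hvU, hvW, hv]
    · rw [e₂ v hvW, List.map_eq_nil_iff] at hv
      simp [hvU, hvW, hv]
  · rintro (_ | ⟨a, l⟩) hl
    · exact absurd rfl hl
    rcases Nat.even_or_odd a with ha | ha
    -- Halving the entries recovers the original label; the parity of the head decides the side.
    · refine (Finset.card_le_card fun v hv => ?_).trans (hp₁ ((a :: l).map (· / 2)))
      obtain ⟨hvU, hv⟩ := Finset.mem_filter.1 hv
      by_cases hvW : v ∈ W
      · rw [e₁ v hvW] at hv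
        simp [hvU, hvW, ← hv, -List.map_cons, Function.comp_def]
      · rw [e₂ v hvW, List.map_eq_cons_iff] at hv
        obtain ⟨b, -, -, rfl, -⟩ := hv
        exact absurd ha (by simp)
    · refine (Finset.card_le_card fun v hv => ?_).trans (hp₂ ((a :: l).map (· / 2)))
      obtain ⟨hvU, hv⟩ := Finset.mem_filter.1 hv
      by_cases hvW : v ∈ W
      · rw [e₁ v hvW, List.map_eq_cons_iff] at hv
        obtain ⟨b, -, -, rfl, -⟩ := hv
        exact absurd ha (by simp)
      · have hdiv : ∀ x, (2 * x + 1) / 2 = x := fun x => by omega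
        rw [e₂ v hvW] at hv
        simp [hvU, hvW, ← hv, -List.map_cons, Function.comp_def, hdiv]

end Construct

/-! ### Tree-partitions with parts of size O(kΔ). -/

section Exists

variable {V : Type*} [Fintype V] {G : SimpleGraph V} [DecidableRel G.Adj] {ι : Type} [Fintype ι]

/-- A graph of treewidth `k` and maximum degree at most `d` has tree-partitions with parts of size
`O(k * d)`, even with a prescribed set `S` in the root part. -/
theorem TreeDecomposition.exists_isTreePartition_of_subset [DecidableEq V]
    (D : TreeDecomposition G ι) {d a : ℕ} (hd : ∀ v, G.degree v ≤ d) (hd1 : 1 ≤ d)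
    (ha : a = 4 * (D.width + 1)) (U : Finset V) :
    ∀ S ⊆ U, S.card ≤ 3 * a * d → ∃ φ : V → List ℕ, G.IsTreePartition U φ ∧
      (∀ v ∈ S, φ v = []) ∧ (U.filter fun v => φ v = []).card ≤ 2 * max S.card a - a ∧
      ∀ l, (U.filter fun v => φ v = l).card ≤ 6 * a * d := by
  induction U using Finset.strongInduction with
  | H U ih =>
    intro S hSU hS
    have had : a ≤ a * d := Nat.le_mul_of_pos_right a hd1
    rw [mul_assoc] at hS ⊢
    rcases U.eq_empty_or_nonempty with rfl | ⟨v₀, hv₀⟩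
    · exact ⟨fun _ => [], by simp [IsTreePartition], by simp, by simp, by simp⟩
    by_cases hsmall : S.card ≤ 3 * a
    -- The root part is `S`, or a single vertex if `S` is empty, so that `U \ R` is strictly
    -- smaller.
    · obtain ⟨R, hRU, hSR, hRne, hR, hRa⟩ : ∃ R ⊆ U, S ⊆ R ∧ R.Nonempty ∧
          R.card ≤ 2 * max S.card a - a ∧ R.card ≤ 3 * a := by
        rcases S.eq_empty_or_nonempty with rfl | hne
        · refine ⟨{v₀}, by simpa using hv₀, by simp, by simp, ?_, ?_⟩ <;>
            simp only [Finset.card_singleton, Finset.card_empty] <;> omega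
        · exact ⟨S, hSU, subset_rfl, hne, by omega, hsmall⟩
      let S' := (U \ R).filter fun v => ∃ u ∈ R, G.Adj u v
      have hS' : S'.card ≤ 3 * a * d := by
        refine (Finset.card_le_card (t := R.biUnion fun u => G.neighborFinset u) fun v hv => ?_).trans
          ((Finset.card_biUnion_le_card_mul _ _ d fun u _ => ?_).trans
            (Nat.mul_le_mul_right d hRa))
        · obtain ⟨-, u, hu, huv⟩ := Finset.mem_filter.1 hv
          exact Finset.mem_biUnion.2 ⟨u, hu, (G.mem_neighborFinset u v).2 huv⟩
        · rw [card_neighborFinset_eq_degree]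
          exact hd u
      obtain ⟨φ, hφ, hroot, -, hp⟩ := ih (U \ R) (Finset.sdiff_ssubset hRU hRne) S'
        (Finset.filter_subset _ _) hS'
      refine ⟨_, hφ.cons fun u hu v hv huv => hroot v (Finset.mem_filter.2 ⟨hv, u, hu, huv⟩),
        fun v hv => if_pos (hSR hv), ?_, card_filter_cons_le (by omega) fun l => ?_⟩
      · refine (Finset.card_le_card fun v hv => ?_).trans hR
        by_contra hvR
        simp [hvR] at hv
      · rw [← mul_assoc]
        exact hp l
    -- As |S| > 3a and a ≤ |S ∩ W| ≤ 2a, both sides keep at least a vertices of `S`, so each maximum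
    -- in the root bounds is the size of the new prescribed set.
    · obtain ⟨X, W, hXW, hX, hW, hle, hge⟩ := D.exists_separation (S := S) (m := a)
        (by omega) (by omega)
      have hcard := Finset.card_inter_add_card_sdiff S W
      have hXU : (X ∩ U).card ≤ D.width + 1 :=
        (Finset.card_le_card Finset.inter_subset_left).trans hX
      have c₁ := Finset.card_union_le (S ∩ W) (X ∩ U)
      have c₂ := Finset.card_union_le (S \ W) (X ∩ U)
      have c₁' := Finset.card_le_card (Finset.subset_union_left (s₁ := S ∩ W) (s₂ := X ∩ U))
      have c₂' := Finset.card_le_card (Finset.subset_union_left (s₁ := S \ W) (s₂ := X ∩ U))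
      have hU₁ : U ∩ W ⊂ U := by
        obtain ⟨v, hv⟩ : (S \ W).Nonempty := Finset.card_pos.1 (by omega)
        rw [Finset.mem_sdiff] at hv
        exact (Finset.ssubset_iff_of_subset Finset.inter_subset_left).2
          ⟨v, hSU hv.1, fun h => hv.2 (Finset.mem_inter.1 h).2⟩
      have hU₂ : (U.filter fun v => v ∈ W → v ∈ X) ⊂ U := by
        obtain ⟨v, hv, hvX⟩ : ∃ v ∈ S ∩ W, v ∉ X := Finset.exists_mem_notMem_of_card_lt_card
          (by omega)
        rw [Finset.mem_inter] at hv
        exact (Finset.ssubset_iff_of_subset (Finset.filter_subset _ _)).2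
          ⟨v, hSU hv.1, fun h => hvX ((Finset.mem_filter.1 h).2 hv.2)⟩
      obtain ⟨φ₁, h₁, hr₁, hq₁, hp₁⟩ := ih (U ∩ W) hU₁ (S ∩ W ∪ X ∩ U)
        (Finset.union_subset (Finset.inter_subset_inter_right hSU) fun v hv => by
          rw [Finset.mem_inter] at hv ⊢
          exact ⟨hv.2, hXW hv.1⟩) (by rw [mul_assoc]; omega)
      obtain ⟨φ₂, h₂, hr₂, hq₂, hp₂⟩ := ih (U.filter fun v => v ∈ W → v ∈ X) hU₂ (S \ W ∪ X ∩ U)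
        (Finset.union_subset (fun v hv => by
          rw [Finset.mem_sdiff] at hv
          exact Finset.mem_filter.2 ⟨hSU hv.1, fun h => absurd h hv.2⟩) fun v hv => by
          rw [Finset.mem_inter] at hv
          exact Finset.mem_filter.2 ⟨hv.2, fun _ => hv.1⟩) (by rw [mul_assoc]; omega)
      obtain ⟨φ, h, hr, hr', hq, hp⟩ := exists_isTreePartition_glue hW h₁ h₂
        (fun v hv => hr₁ v (Finset.mem_union_right _ hv))
        (fun v hv => hr₂ v (Finset.mem_union_right _ hv)) hp₁ hp₂ hq₁ hq₂
      -- The two root bounds add up to at most 2|S| + 4|X ∩ U| - 2a ≤ 2|S| - a, because 4(width + 1)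
      -- = a: hence the factor 4 in `a` and the `- a` in the induction hypothesis.
      refine ⟨φ, h, fun v hv => ?_, by omega, fun l => ?_⟩
      · by_cases hvW : v ∈ W
        · exact hr v hvW (hr₁ v (Finset.mem_union_left _ (Finset.mem_inter.2 ⟨hv, hvW⟩)))
        · exact hr' v hvW (hr₂ v (Finset.mem_union_left _ (Finset.mem_sdiff.2 ⟨hv, hvW⟩)))
      · by_cases hl : l = []
        · subst hl
          refine hq.trans ?_
          omega
        · rw [← mul_assoc]
          exact hp l hl

end Exists

/-! ### From tree-partitions to domino tree decompositions. -/

section DominoTreewidth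

variable {V : Type*} [Fintype V] [Nonempty V] {G : SimpleGraph V} [DecidableRel G.Adj]

/-- The bag of a node consists of its part and of the neighbours of its part in the child parts. -/
theorem IsTreePartition.dominoTreewidth_le {φ : V → List ℕ}
    (hφ : G.IsTreePartition Finset.univ φ) {p d w : ℕ} (hd : ∀ v, G.degree v ≤ d)
    (hp : ∀ l, (Finset.univ.filter fun v => φ v = l).card ≤ p) (hw : p * (d + 1) ≤ w + 1) :
    G.dominoTreewidth ≤ w := by
  classical
  -- Suffixes of labels form a finite set closed under taking parents.
  let ι := {l : List ℕ // ∃ v, l <:+ φ v}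
  have : Finite ι := Set.Finite.to_subtype (s := {l : List ℕ | ∃ v, l <:+ φ v}) <| by
    refine (Set.finite_iUnion fun v => (φ v).tails.finite_toSet).subset fun l ⟨v, hv⟩ => ?_
    exact Set.mem_iUnion.2 ⟨v, (List.mem_tails _ _).2 hv⟩
  have : Fintype ι := Fintype.ofFinite ι
  let par : ι → ι := fun l => ⟨l.1.tail, l.2.imp fun v hv => (List.tail_suffix _).trans hv⟩
  let r : ι := ⟨[], Classical.arbitrary V, List.nil_suffix⟩
  let node : V → ι := fun v => ⟨φ v, v, List.suffix_rfl⟩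
  have hr : par r = r := rfl
  have hh : ∀ l : ι, l ≠ r → (par l).1.length < l.1.length := by
    rintro ⟨l, hl⟩ hne
    have : l ≠ [] := fun h => hne (Subtype.ext h)
    have := List.length_pos_iff.2 this
    simp only [par, List.length_tail]
    omega
  let bag : ι → Finset V := fun l => Finset.univ.filter fun v =>
    φ v = l.1 ∨ ((φ v).tail = l.1 ∧ ∃ u, G.Adj u v ∧ φ u = l.1)
  have hbag : ∀ v l, v ∈ bag l ↔ φ v = l.1 ∨ ((φ v).tail = l.1 ∧ ∃ u, G.Adj u v ∧ φ u = l.1) :=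
    fun v l => Finset.mem_filter_univ _
  have hnode : ∀ v l, v ∈ bag l → l = node v ∨ l = par (node v) := fun v l h =>
    ((hbag v l).1 h).imp (fun h => Subtype.ext h.symm) fun h => Subtype.ext h.1.symm
  let D : TreeDecomposition G ι :=
    { tree := parentGraph par
      isTree := isTree_parentGraph (h := fun l : ι => l.1.length) hr hh
      bag := bag
      connected_induce := fun v => by
        have hv : v ∈ bag (node v) := (hbag _ _).2 (.inl rfl)
        refine connected_induce_of_forall_exists_walk (u := node v) hv fun l hl => ?_
        by_cases hne : node v = l
        · subst hne
          exact ⟨.nil, by simpa using hv⟩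
        · have hadj : (parentGraph par).Adj (node v) l :=
            ⟨hne, .inl ((hnode v l hl).resolve_left (Ne.symm hne)).symm⟩
          exact ⟨hadj.toWalk, by simpa using ⟨hv, hl⟩⟩
      exists_bag_of_adj := fun {u v} huv => by
        rcases hφ u (Finset.mem_univ u) v (Finset.mem_univ v) huv with h | h | h
        · exact ⟨node u, (hbag _ _).2 (.inl rfl), (hbag _ _).2 (.inl h.symm)⟩
        · exact ⟨node u, (hbag _ _).2 (.inl rfl), (hbag _ _).2 (.inr ⟨h.symm, u, huv, rfl⟩)⟩
        · exact ⟨node v, (hbag _ _).2 (.inr ⟨h.symm, v, huv.symm, rfl⟩), (hbag _ _).2 (.inl rfl)⟩ }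
  have hD : D.IsDomino := fun v =>
    (Set.ncard_le_ncard (t := {node v, par (node v)}) (fun l hl => hnode v l hl)
      (Set.toFinite _)).trans (Set.ncard_insert_le _ _ |>.trans (by simp))
  refine (D.dominoTreewidth_le hD).trans (D.width_le fun l => ?_)
  let part := Finset.univ.filter fun v => φ v = l.1
  have hsub : bag l ⊆ part ∪ part.biUnion fun u => G.neighborFinset u := fun v hv => by
    rw [Finset.mem_union, Finset.mem_biUnion]
    rcases (hbag v l).1 hv with h | ⟨-, u, huv, hu⟩
    · exact .inl ((Finset.mem_filter_univ v).2 h)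
    · exact .inr ⟨u, (Finset.mem_filter_univ u).2 hu, (G.mem_neighborFinset u v).2 huv⟩
  have h1 : part.card ≤ p := hp l.1
  have h2 : (part.biUnion fun u => G.neighborFinset u).card ≤ p * d :=
    (Finset.card_biUnion_le_card_mul _ _ d fun u _ =>
      (G.card_neighborFinset_eq_degree u).le.trans (hd u)).trans (Nat.mul_le_mul_right d h1)
  have h3 := (Finset.card_le_card hsub).trans (Finset.card_union_le _ _)
  rw [mul_add, mul_one] at hw
  change (bag l).card ≤ w + 1
  omega

variable (G)

theorem dominoTreewidth_le_mul_treewidth_mul_maxDegree_sq :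
    G.dominoTreewidth ≤ 96 * (G.treewidth * G.maxDegree ^ 2) := by
  classical
  obtain ⟨ι, _, D, hD⟩ := G.exists_width_eq_treewidth
  by_cases hG : ∃ u v, G.Adj u v
  · obtain ⟨u, v, huv⟩ := hG
    have hdeg : 1 ≤ G.maxDegree := (G.degree_pos_iff_exists_adj u |>.2 ⟨v, huv⟩).trans_le
      (G.degree_le_maxDegree u)
    have htw : 1 ≤ G.treewidth := by
      obtain ⟨t, hu, hv⟩ := D.exists_bag_of_adj huv
      have h1 := Finset.card_le_card (Finset.insert_subset hu (Finset.singleton_subset_iff.2 hv))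
      rw [Finset.card_pair huv.ne] at h1
      have h2 := D.card_bag_le t
      omega
    obtain ⟨φ, hφ, -, -, hp⟩ := D.exists_isTreePartition_of_subset G.degree_le_maxDegree hdeg rfl
      Finset.univ ∅ (Finset.empty_subset _) (by simp)
    refine hφ.dominoTreewidth_le G.degree_le_maxDegree hp ?_
    rw [hD]
    -- An edge makes both parameters positive, so each `+ 1` costs a factor 2: 96 = 6 · 4 · 2 · 2.
    calc 6 * (4 * (G.treewidth + 1)) * G.maxDegree * (G.maxDegree + 1)
        ≤ 6 * (4 * (G.treewidth + G.treewidth)) * G.maxDegree * (G.maxDegree + G.maxDegree) := by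
          gcongr
      _ = 96 * (G.treewidth * G.maxDegree ^ 2) := by ring
      _ ≤ _ := Nat.le_succ _
  · push Not at hG
    let e := Fintype.equivFin V
    -- Without edges the right-hand side is 0, so width 0 is needed: all parts are singletons.
    have hφ : G.IsTreePartition Finset.univ fun v => [(e v : ℕ)] :=
      fun u _ v _ huv => absurd huv (hG u v)
    refine (hφ.dominoTreewidth_le (p := 1) (d := 0) (w := 0) (fun v => ?_) (fun l => ?_)
      (by simp)).trans (Nat.zero_le _)
    · rw [Nat.le_zero, ← card_neighborFinset_eq_degree, Finset.card_eq_zero]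
      ext u
      simp [hG v u]
    · refine Finset.card_le_one.2 fun u hu v hv => ?_
      rw [Finset.mem_filter_univ] at hu hv
      have := hu.trans hv.symm
      simpa [Fin.val_inj] using this

end DominoTreewidth

end SimpleGraph

theorem theorem10p5 :
    -- treespan and domino treewidth are polynomially tied
    SimpleGraph.PolynomiallyTied.{u} (fun _ _ G => G.treespan) (fun _ _ G => G.dominoTreewidth) ∧
    -- the explicit bounds: `max(tw, Δ/2) ≤ ts ≤ 2 dtw`
    (∀ (V : Type u) [Fintype V] [Nonempty V] (G : SimpleGraph V) [DecidableRel G.Adj],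
      max (G.treewidth : ℚ) ((G.maxDegree : ℚ) / 2) ≤ (G.treespan : ℚ) ∧
      G.treespan ≤ 2 * G.dominoTreewidth) ∧
    -- the bound `dtw = O(tw Δ²)`
    (∃ C : ℕ, ∀ (V : Type u) [Fintype V] [Nonempty V] (G : SimpleGraph V) [DecidableRel G.Adj],
      G.dominoTreewidth ≤ C * (G.treewidth * G.maxDegree ^ 2)) := by
  -- 384 = 96 · 2², from tw ≤ ts and Δ ≤ 2 ts.
  refine ⟨⟨2 * X, C 384 * X ^ 3, fun V _ _ G => ⟨?_, ?_⟩⟩, fun V _ _ G _ => ⟨?_, ?_⟩, 96,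
    fun V _ _ G _ => G.dominoTreewidth_le_mul_treewidth_mul_maxDegree_sq⟩
  · simpa using G.treespan_le_two_mul_dominoTreewidth
  · classical
    have h1 := G.treewidth_le_treespan
    have h2 := G.maxDegree_le_two_mul_treespan
    rw [eval_mul, eval_C, eval_pow, eval_X]
    calc G.dominoTreewidth ≤ 96 * (G.treewidth * G.maxDegree ^ 2) :=
          G.dominoTreewidth_le_mul_treewidth_mul_maxDegree_sq
      _ ≤ 96 * (G.treespan * (2 * G.treespan) ^ 2) := by gcongr
      _ = 384 * G.treespan ^ 3 := by ring
  · have h : (G.maxDegree : ℚ) ≤ 2 * G.treespan := mod_cast G.maxDegree_le_two_mul_treespan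
    exact max_le (mod_cast G.treewidth_le_treespan) (by linarith)
  · exact G.treespan_le_two_mul_dominoTreewidth
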